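/- Consider the stochastic block model with $Q$ classes and parameter $(\alpha,\pi)$, where $\alpha=(\alpha_1,\dots,\alpha_Q)$ is a probability vector and $\pi=(\pi_{q,l})\in[0,1]^{Q\times Q}$: the labels $Z=(Z_i)_{i\ge1}$ are i.i.d. with $\mathbb P(Z_i=q)=\alpha_q$, and, given $Z$, the entries $X_{i,j}\in\{0,1\}$ ($i\ne j$) of the adjacency matrix are independent, $X_{i,j}$ being Bernoulli with parameter $\pi_{Z_i,Z_j}$, while $X_{i,i}=0$. Write $Z_{[n]}=(Z_1,\dots,Z_n)$, $X_{[n]}=(X_{i,j})_{1\le i,j\le n}$ and $P^*=\mathbb P(\cdot\mid Z=z^*)$ for a label sequence $z^*$. Let $P^{X_{[n]}}=\mathbb P(Z_{[n]}=\cdot\mid X_{[n]})$ be the posterior distribution under the same parameter $(\alpha,\pi)$, and let $$\mathcal D_n=\Big\{\textstyle\prod_{i=1}^n\mathcal M(1;\tau_{i,1},\dots,\tau_{i,Q})\ :\ \tau_{i,q}\in[0,1],\ \sum_{q=1}^Q\tau_{i,q}=1\text{ for all }i\Big\}$$ be the set of product-multinomial distributions on $\{1,\dots,Q\}^n$. Label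 vectors are considered up to the equivalence $z_{[n]}\sim z'_{[n]}$ iff there is a permutation $\sigma$ of $\{1,\dots,Q\}$ with $\pi_{\sigma(q),\sigma(l)}=\pi_{q,l}$ for all $q,l$ and $z'_i=\sigma(z_i)$ for all $i\le n$ (this is equality if only the identity leaves $\pi$ invariant). For a distribution $D$ on $\{1,\dots,Q\}^n$ let $[D]$ be the induced distribution on the equivalence classes, and let $K$ denote the Kullback–Leibler divergence, with values in $[0,+\infty]$. Assume: - (A1) for all $q\neq q'$ there is $l$ such that $\pi_{q,l}\ne\pi_{q',l}$ or $\pi_{l,q}\neq\pi_{l,q'}$; - (A2) there is $\zeta>0$ such that, for all $q,l$, $\pi_{q,l}\in(0,1)$ implies $\pi_{q,l}\in[\zeta,1-\zeta]$; - (A3) there is $0<\gamma<1/Q$ such that $\alpha_q\in[\gamma,1-\gamma]$ for all $q$. Then $$\inf_{D\in\mathcal D_n}K\big([D],[P^{X_{[n]}}]\big)\xrightarrow[n\to\infty]{}0\qquad P^*\text{-almost surely},$$ for almost every $z^*$ with respect to the law of $Z$, and moreover for every individual sequence $z^*$ for which there are $\gamma'>0$ and $n_0\ge1$ such that $|\{i\le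 n: z^*_i=q\}|\ge\gamma' n$ for all $q\in\{1,\dots,Q\}$ and all $n\ge n_0$. -/

import Mathlib

open MeasureTheory ProbabilityTheory Filter Topology
open scoped ENNReal

noncomputable section

namespace SBM

variable {Q : ℕ}

/-- The multinomial distribution `M(1; p_1, …, p_Q)` on the label set `{1, …, Q}`
(represented by `Fin Q`): label `q` has probability `p q`. -/
def categorical (p : stdSimplex ℝ (Fin Q)) : Measure (Fin Q) :=
  ∑ q, ENNReal.ofReal (p q) • Measure.dirac q

instance (p : stdSimplex ℝ (Fin Q)) : IsProbabilityMeasure (categorical p) := by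
  constructor
  have h1 : ∑ q, p q = 1 := p.2.2
  have h : ∑ q, ENNReal.ofReal (p q) = 1 :=
    calc ∑ q, ENNReal.ofReal (p q) = ENNReal.ofReal (∑ q, p q) :=
          (ENNReal.ofReal_sum_of_nonneg (fun q _ => p.2.1 q)).symm
      _ = 1 := by rw [h1, ENNReal.ofReal_one]
  simpa [categorical] using h

/-- Label sequences `z = (z_i)` of the countably many vertices. -/
abbrev Labels (Q : ℕ) : Type := ℕ → Fin Q

/-- Infinite adjacency matrices; the entry at `(i, j)` is `true` iff there is an edge from the
vertex `i` to the vertex `j`. -/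
abbrev Adjacency : Type := ℕ × ℕ → Bool

/-- The law of the label sequence `Z`: independent labels with common distribution `α`. -/
def labelLaw (α : stdSimplex ℝ (Fin Q)) : Measure (Labels Q) :=
  Measure.infinitePi fun _ : ℕ => categorical α

instance (α : stdSimplex ℝ (Fin Q)) : IsProbabilityMeasure (labelLaw α) := by
  unfold labelLaw; infer_instance

/-- The conditional law of the entry `X_{i,j}` when `Z_i = q` and `Z_j = l`: Bernoulli with
parameter `π q l` off the diagonal, and `0` on the diagonal. -/
def entryLaw (π : Fin Q → Fin Q → unitInterval) (e : ℕ × ℕ) (q l : Fin Q) : Measure Bool :=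
  if e.1 = e.2 then Measure.dirac false else bernoulliMeasure true false (π q l)

instance (π : Fin Q → Fin Q → unitInterval) (e : ℕ × ℕ) (q l : Fin Q) :
    IsProbabilityMeasure (entryLaw π e q l) := by
  unfold entryLaw; split_ifs <;> infer_instance

/-- The law of the adjacency matrix when the label sequence is `z`: independent entries. -/
def edgeLaw (π : Fin Q → Fin Q → unitInterval) (z : Labels Q) : Measure Adjacency :=
  Measure.infinitePi fun e : ℕ × ℕ => entryLaw π e (z e.1) (z e.2)

instance (π : Fin Q → Fin Q → unitInterval) (z : Labels Q) :
    IsProbabilityMeasure (edgeLaw π z) := by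
  unfold edgeLaw; infer_instance

theorem measurable_edgeLaw (π : Fin Q → Fin Q → unitInterval) : Measurable (edgeLaw π) := by
  have hpi : IsPiSystem (squareCylinders fun _ : ℕ × ℕ => {s : Set Bool | MeasurableSet s}) :=
    isPiSystem_squareCylinders (fun _ => MeasurableSpace.isPiSystem_measurableSet)
      (by simp)
  have hgen : (MeasurableSpace.pi : MeasurableSpace Adjacency) = MeasurableSpace.generateFrom
      (squareCylinders fun _ : ℕ × ℕ => {s : Set Bool | MeasurableSet s}) :=
    generateFrom_squareCylinders.symm
  refine Measurable.measure_of_isPiSystem_of_isProbabilityMeasure hgen hpi ?_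
  rintro _ ⟨s, t, -, rfl⟩
  have h : ∀ z : Labels Q, edgeLaw π z ((s : Set (ℕ × ℕ)).pi t)
      = ∏ e ∈ s, entryLaw π e (z e.1) (z e.2) (t e) := fun z =>
    Measure.infinitePi_pi _ (fun e _ => MeasurableSet.of_discrete)
  simp only [h]
  refine Finset.measurable_fun_prod s fun e _ => ?_
  have hg : Measurable (Function.uncurry fun q l : Fin Q => entryLaw π e q l (t e)) :=
    Measurable.of_discrete
  have hz : Measurable fun z : Labels Q => (z e.1, z e.2) :=
    (measurable_pi_apply e.1).prodMk (measurable_pi_apply e.2)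
  have hgz := hg.comp hz
  simpa only [Function.comp_def, Function.uncurry] using hgz

/-- The Markov kernel `z ↦ P(X ∈ · | Z = z)` of the stochastic block model. For a fixed label
sequence `z*`, the measure `trueLaw π z*` is the distribution `P*` of the infinite adjacency
matrix given `Z = z*`. -/
def trueLaw (π : Fin Q → Fin Q → unitInterval) : Kernel (Labels Q) Adjacency where
  toFun := edgeLaw π
  measurable' := measurable_edgeLaw π

instance (π : Fin Q → Fin Q → unitInterval) : IsMarkovKernel (trueLaw π) :=
  ⟨fun z => inferInstanceAs (IsProbabilityMeasure (edgeLaw π z))⟩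

/-- The stochastic block model with parameter `(α, π)`: the joint law of the label sequence `Z`
and of the adjacency matrix `X`. -/
def model (α : stdSimplex ℝ (Fin Q)) (π : Fin Q → Fin Q → unitInterval) :
    Measure (Labels Q × Adjacency) :=
  labelLaw α ⊗ₘ trueLaw π

/-- The labels `z_[n]` of the first `n` vertices. -/
def labelsUpTo (n : ℕ) (z : Labels Q) : Fin n → Fin Q := fun i => z i

/-- The adjacency matrix `x_[n]` of the first `n` vertices. -/
def adjacencyUpTo (n : ℕ) (x : Adjacency) : Fin n × Fin n → Bool := fun e => x (e.1, e.2)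

/-- The posterior distribution of `Z_[n]` given `X_[n] = x_[n]` in the model with parameter
`(α, π)`. (The observation `X_[n]` takes finitely many values, so that the conditioning is
elementary.) -/
def posterior (α : stdSimplex ℝ (Fin Q)) (π : Fin Q → Fin Q → unitInterval) (n : ℕ)
    (x : Adjacency) : Measure (Fin n → Fin Q) :=
  (ProbabilityTheory.cond (model α π)
    {ω | adjacencyUpTo n ω.2 = adjacencyUpTo n x}).map (fun ω => labelsUpTo n ω.1)

/-- The permutations `σ` of the labels that leave `π` invariant. -/
def invariantPerms (π : Fin Q → Fin Q → unitInterval) : Set (Equiv.Perm (Fin Q)) :=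
  {σ | ∀ q l, π (σ q) (σ l) = π q l}

/-- Two label vectors are equivalent if one is obtained from the other by relabelling with a
permutation that leaves `π` invariant. If only the identity leaves `π` invariant, this is
equality. -/
def labelSetoid (π : Fin Q → Fin Q → unitInterval) (n : ℕ) : Setoid (Fin n → Fin Q) where
  r z z' := ∃ σ ∈ invariantPerms π, ∀ i, z' i = σ (z i)
  iseqv :=
    { refl := fun _ => ⟨1, fun _ _ => rfl, fun _ => rfl⟩
      symm := by
        rintro z z' ⟨σ, hσ, h⟩
        refine ⟨σ⁻¹, fun q l => ?_, fun i => by simp [h i]⟩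
        have := hσ (σ⁻¹ q) (σ⁻¹ l)
        simpa using this.symm
      trans := by
        rintro z z' z'' ⟨σ, hσ, h⟩ ⟨τ, hτ, h'⟩
        exact ⟨τ * σ, fun q l => (hτ (σ q) (σ l)).trans (hσ q l), fun i => by
          simp [h' i, h i]⟩ }

/-- The equivalence classes of label vectors of length `n`. -/
abbrev LabelClass (π : Fin Q → Fin Q → unitInterval) (n : ℕ) : Type :=
  Quotient (labelSetoid π n)

/-- The distribution of the equivalence class of a random label vector with distribution `μ`. -/
def classLaw (π : Fin Q → Fin Q → unitInterval) {n : ℕ} (μ : Measure (Fin n → Fin Q)) :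
    Measure (LabelClass π n) :=
  μ.map (Quotient.mk (labelSetoid π n))

/-- The product multinomial distribution `D_τ = ∏_i M(1; τ_{i,1}, …, τ_{i,Q})`. -/
def productMultinomial {n : ℕ} (τ : Fin n → stdSimplex ℝ (Fin Q)) : Measure (Fin n → Fin Q) :=
  Measure.pi fun i => categorical (τ i)

/-- The set `D_n` of product multinomial distributions. -/
def productMultinomials (Q n : ℕ) : Set (Measure (Fin n → Fin Q)) :=
  Set.range productMultinomial

/-- The minimal Kullback-Leibler divergence (with value in `[0, ∞]`) between the product multinomial
distributions and the posterior distribution of `Z_[n]` given `X_[n] = x_[n]`, all of them being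
seen as distributions of the equivalence class of the label vector. -/
def minKL (α : stdSimplex ℝ (Fin Q)) (π : Fin Q → Fin Q → unitInterval) (n : ℕ)
    (x : Adjacency) : ℝ≥0∞ :=
  ⨅ D ∈ productMultinomials Q n,
    InformationTheory.klDiv (classLaw π D) (classLaw π (posterior α π n x))

/-- The number `N_q(z_[n])` of the first `n` vertices that have label `q`. -/
def labelCount (z : Labels Q) (q : Fin Q) (n : ℕ) : ℕ :=
  (Finset.univ.filter fun i : Fin n => labelsUpTo n z i = q).card

end SBM

end

/-! Write `y` for the true labels of the first `n` vertices. The point mass at `y` is a product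
multinomial distribution, and its divergence from the posterior on classes is `-log p`, with `p` the
posterior mass of the class of `y`. Since `-log p ≤ 1/p - 1`, the infimum is at most the posterior
odds against that class (`minKL_le_odds`), so it suffices that these odds tend to `0`.

A likelihood ratio may have expectation `1` under `P*`, but its square root has expectation at most
a product of Bhattacharyya affinities, that is `ρ ^ N` with `ρ < 1` and `N` the number of entries
whose parameters differ under `z` and `y` (`lintegral_rootRatio_le`). When every label is frequent
in `y`, identifiability gives `N ≥ c n d`, where `d` is the Hamming distance from `z` to a suitable
relabelling of `y` (`exists_perm_hammingDist_le`). The prior ratio costs only a constant factor per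
disagreement, so the odds are at most the square of a sum with expectation at most `∑ t ^ d`, where
`t = β (ρ ^ c) ^ n` (`odds_le_sq`, `lintegral_rootOdds_le`). Over vectors outside the class this is
of order `n t`, which is summable in `n`, and almost sure convergence follows.

For random labels, the strong law of large numbers makes every label frequent. -/

open scoped NNReal

noncomputable section

namespace SBM

variable {Q : ℕ}

/-! ### Cylinder probabilities and Bayes' formula for the posterior. -/

/-- The mass that the conditional law of the entry `e` gives to `b`. -/
def entryMass (π : Fin Q → Fin Q → unitInterval) (e : ℕ × ℕ) (q l : Fin Q) (b : Bool) : ℝ≥0 :=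
  (entryLaw π e q l {b}).toNNReal

/-- The likelihood of the label vector `z` for the first `n` vertices of `x`. -/
def likelihood (π : Fin Q → Fin Q → unitInterval) (n : ℕ) (z : Fin n → Fin Q)
    (x : Adjacency) : ℝ≥0 :=
  ∏ e : Fin n × Fin n, entryMass π (e.1, e.2) (z e.1) (z e.2) (x (e.1, e.2))

/-- The probability of the label vector `z` under independent labels with distribution `α`. -/
def prior (α : stdSimplex ℝ (Fin Q)) {n : ℕ} (z : Fin n → Fin Q) : ℝ≥0 :=
  ∏ i, (α (z i)).toNNReal

/-- The edges between the first `n` vertices, as edges of the infinite graph. -/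
def edgeEmbedding (n : ℕ) : Fin n × Fin n ↪ ℕ × ℕ :=
  Fin.valEmbedding.prodMap Fin.valEmbedding

theorem coe_entryMass (π : Fin Q → Fin Q → unitInterval) (e : ℕ × ℕ) (q l : Fin Q) (b : Bool) :
    (entryMass π e q l b : ℝ≥0∞) = entryLaw π e q l {b} :=
  ENNReal.coe_toNNReal (measure_ne_top _ _)

theorem categorical_singleton (α : stdSimplex ℝ (Fin Q)) (q : Fin Q) :
    categorical α {q} = ((α q).toNNReal : ℝ≥0∞) := by
  classical
  rw [categorical, Measure.finsetSum_apply]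
  simp [Measure.smul_apply, Set.indicator_apply, ENNReal.ofReal]

theorem edgeLaw_cylinder (π : Fin Q → Fin Q → unitInterval) (zs : Labels Q) (n : ℕ)
    (x : Adjacency) :
    edgeLaw π zs {x' | adjacencyUpTo n x' = adjacencyUpTo n x} =
      likelihood π n (labelsUpTo n zs) x := by
  have hset : {x' | adjacencyUpTo n x' = adjacencyUpTo n x} =
      ((Finset.univ.map (edgeEmbedding n) : Finset (ℕ × ℕ)) : Set (ℕ × ℕ)).pi
        (fun e => ({x e} : Set Bool)) := by
    ext x'
    simp only [adjacencyUpTo, funext_iff, edgeEmbedding, Set.mem_pi, Set.mem_ofPred_eq,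
      Finset.coe_map, Finset.coe_univ, Set.image_univ, Set.mem_range, Set.mem_singleton_iff,
      forall_exists_index, forall_apply_eq_imp_iff]
    rfl
  rw [hset, edgeLaw, Measure.infinitePi_pi _ (fun _ _ => MeasurableSet.of_discrete),
    Finset.prod_map, likelihood]
  push_cast
  refine Finset.prod_congr rfl fun e _ => ?_
  rw [coe_entryMass]; rfl

theorem labelLaw_cylinder (α : stdSimplex ℝ (Fin Q)) (n : ℕ) (z : Fin n → Fin Q) :
    labelLaw α {zs | labelsUpTo n zs = z} = prior α z := by
  -- The factors are indexed by `ℕ` while `z` lives on `Fin n`, so the constraint at `i` quantifies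
  -- over proofs of `i < n`.
  have hset : {zs | labelsUpTo n zs = z} =
      (((Finset.univ : Finset (Fin n)).map Fin.valEmbedding : Finset ℕ) : Set ℕ).pi
        (fun i => {q | ∀ h : i < n, q = z ⟨i, h⟩}) := by
    ext zs
    simp only [labelsUpTo, funext_iff, Set.mem_pi, Set.mem_ofPred_eq,
      Finset.coe_map, Finset.coe_univ, Set.image_univ, Set.mem_range,
      forall_exists_index, forall_apply_eq_imp_iff]
    exact ⟨fun h i _ => h i, fun h i => h i i.2⟩
  rw [hset, labelLaw, Measure.infinitePi_pi _ (fun _ _ => MeasurableSet.of_discrete),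
    Finset.prod_map, prior]
  push_cast
  refine Finset.prod_congr rfl fun i _ => ?_
  rw [← categorical_singleton]
  congr 1
  ext q
  simp

theorem measurable_labelsUpTo (n : ℕ) : Measurable (labelsUpTo (Q := Q) n) :=
  measurable_pi_lambda _ fun i => measurable_pi_apply (i : ℕ)

theorem measurable_adjacencyUpTo (n : ℕ) : Measurable (adjacencyUpTo n) :=
  measurable_pi_lambda _ fun _ => measurable_pi_apply _

/-- The kernel's mass of the adjacency cylinder depends only on the first `n` labels, hence is
constant on the label cylinder and leaves the integral. -/
theorem model_cylinder (α : stdSimplex ℝ (Fin Q)) (π : Fin Q → Fin Q → unitInterval) (n : ℕ)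
    (x : Adjacency) (z : Fin n → Fin Q) :
    model α π ({ω | adjacencyUpTo n ω.2 = adjacencyUpTo n x} ∩ {ω | labelsUpTo n ω.1 = z}) =
      ((prior α z * likelihood π n z x : ℝ≥0) : ℝ≥0∞) := by
  have hA : MeasurableSet {x' | adjacencyUpTo n x' = adjacencyUpTo n x} :=
    measurable_adjacencyUpTo n (measurableSet_singleton _)
  have hB : MeasurableSet {zs : Labels Q | labelsUpTo n zs = z} :=
    measurable_labelsUpTo n (measurableSet_singleton _)
  have hset : ({ω | adjacencyUpTo n ω.2 = adjacencyUpTo n x} ∩ {ω | labelsUpTo n ω.1 = z}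
      : Set (Labels Q × Adjacency)) =
      {zs | labelsUpTo n zs = z} ×ˢ {x' | adjacencyUpTo n x' = adjacencyUpTo n x} := by
    ext ω; simp [and_comm]
  rw [hset, model, Measure.compProd_apply_prod hB hA]
  have : ∀ zs ∈ {zs : Labels Q | labelsUpTo n zs = z},
      trueLaw π zs {x' | adjacencyUpTo n x' = adjacencyUpTo n x} = likelihood π n z x := by
    rintro zs rfl
    exact edgeLaw_cylinder π zs n x
  rw [setLIntegral_congr_fun hB this, setLIntegral_const, labelLaw_cylinder]
  push_cast
  ring

/-- The joint probability of the label vectors in `S` and of the adjacency matrix `x_[n]`. -/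
theorem model_inter_labels (α : stdSimplex ℝ (Fin Q)) (π : Fin Q → Fin Q → unitInterval) (n : ℕ)
    (x : Adjacency) (S : Finset (Fin n → Fin Q)) :
    model α π ({ω | adjacencyUpTo n ω.2 = adjacencyUpTo n x} ∩
        {ω | labelsUpTo n ω.1 ∈ S}) =
      ((∑ z ∈ S, prior α z * likelihood π n z x : ℝ≥0) : ℝ≥0∞) := by
  have hset : ({ω | adjacencyUpTo n ω.2 = adjacencyUpTo n x} ∩ {ω | labelsUpTo n ω.1 ∈ S}
      : Set (Labels Q × Adjacency)) =
      ⋃ z ∈ S, ({ω | adjacencyUpTo n ω.2 = adjacencyUpTo n x} ∩ {ω | labelsUpTo n ω.1 = z}) := by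
    ext ω; simp
  rw [hset, measure_biUnion_finset]
  · simp_rw [model_cylinder]
    push_cast
    rfl
  · intro z _ z' _ hzz'
    refine Set.disjoint_left.2 fun ω h h' => hzz' ?_
    exact h.2.symm.trans h'.2
  · intro z _
    exact ((measurable_adjacencyUpTo n).comp measurable_snd (measurableSet_singleton _)).inter
      ((measurable_labelsUpTo n).comp measurable_fst (measurableSet_singleton _))

theorem posterior_apply (α : stdSimplex ℝ (Fin Q)) (π : Fin Q → Fin Q → unitInterval) (n : ℕ)
    (x : Adjacency) (S : Finset (Fin n → Fin Q)) :
    posterior α π n x S =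
      ((∑ z, prior α z * likelihood π n z x : ℝ≥0) : ℝ≥0∞)⁻¹ *
        ((∑ z ∈ S, prior α z * likelihood π n z x : ℝ≥0) : ℝ≥0∞) := by
  have hm : Measurable fun ω : Labels Q × Adjacency => labelsUpTo n ω.1 :=
    (measurable_labelsUpTo n).comp measurable_fst
  have hE : MeasurableSet {ω : Labels Q × Adjacency | adjacencyUpTo n ω.2 = adjacencyUpTo n x} :=
    (measurable_adjacencyUpTo n).comp measurable_snd (measurableSet_singleton _)
  rw [posterior, Measure.map_apply hm MeasurableSet.of_discrete, cond_apply hE]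
  have h1 := model_inter_labels α π n x Finset.univ
  simp only [Finset.mem_univ, Set.ofPred_true, Set.inter_univ] at h1
  rw [h1, ← model_inter_labels α π n x S]
  rfl

instance (π : Fin Q → Fin Q → unitInterval) (n : ℕ) :
    MeasurableSingletonClass (LabelClass π n) :=
  ⟨fun _ => measurableSet_quotient.2 MeasurableSet.of_discrete⟩

theorem measurable_labelClass_mk (π : Fin Q → Fin Q → unitInterval) (n : ℕ) :
    Measurable (Quotient.mk (labelSetoid π n)) :=
  measurable_quotient_mk''

/-! ### Point masses: their divergence, and their place among product multinomials. -/

theorem klDiv_dirac_eq {X : Type*} [MeasurableSpace X] [MeasurableSingletonClass X]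
    (ν : Measure X) [IsProbabilityMeasure ν] (c : X) (hc : ν {c} ≠ 0) :
    InformationTheory.klDiv (Measure.dirac c) ν = ENNReal.ofReal (-Real.log (ν.real {c})) := by
  have hac : Measure.dirac c ≪ ν := by
    intro s hs
    rw [Measure.dirac_apply, Set.indicator_of_notMem]
    intro hcs
    exact hc (measure_mono_null (Set.singleton_subset_iff.2 hcs) hs)
  -- Integrating the density over the atom `{c}` determines its value there as `1 / ν {c}`.
  have hrn : (Measure.dirac c).rnDeriv ν c * ν {c} = 1 := by
    have := Measure.setLIntegral_rnDeriv hac {c}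
    rw [lintegral_singleton] at this
    simpa using this
  have hint : Integrable (llr (Measure.dirac c) ν) (Measure.dirac c) :=
    integrable_dirac (by simp)
  rw [InformationTheory.klDiv_of_ac_of_integrable hac hint, integral_dirac]
  simp only [llr, measureReal_def, measure_univ]
  have h2 : ((Measure.dirac c).rnDeriv ν c).toReal = ((ν {c}).toReal)⁻¹ := by
    have := congrArg ENNReal.toReal hrn
    rw [ENNReal.toReal_mul, ENNReal.toReal_one] at this
    exact eq_inv_of_mul_eq_one_left this
  rw [h2, Real.log_inv]
  simp

theorem productMultinomial_vertex {n : ℕ} (z : Fin n → Fin Q) :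
    ∃ τ : Fin n → stdSimplex ℝ (Fin Q), productMultinomial τ = Measure.dirac z := by
  classical
  refine ⟨fun i => ⟨Pi.single (z i) 1, single_mem_stdSimplex ℝ (z i)⟩, ?_⟩
  refine Measure.ext_of_singleton fun y => ?_
  rw [productMultinomial, Measure.pi_singleton]
  have hs : ∀ i, categorical ⟨Pi.single (z i) 1, single_mem_stdSimplex ℝ (z i)⟩ {y i} =
      if y i = z i then 1 else 0 := by
    intro i
    rw [categorical_singleton]
    change (((Pi.single (z i) 1 : Fin Q → ℝ) (y i)).toNNReal : ℝ≥0∞) = _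
    rw [Pi.single_apply]
    split_ifs <;> simp
  simp_rw [hs]
  rw [Finset.prod_ite_zero, Measure.dirac_apply]
  simp [Set.indicator_apply, funext_iff, eq_comm]

/-! ### Combinatorics: counting the entries that separate two label vectors. -/

/-- The entries off the diagonal whose Bernoulli parameter is not the same under the label
vectors `z` and `y`. -/
def differingEntries (π : Fin Q → Fin Q → unitInterval) {n : ℕ} (z y : Fin n → Fin Q) :
    Finset (Fin n × Fin n) := by
  classical
  exact {e | e.1 ≠ e.2 ∧ π (z e.1) (z e.2) ≠ π (y e.1) (y e.2)}

theorem mem_differingEntries {π : Fin Q → Fin Q → unitInterval} {n : ℕ} {z y : Fin n → Fin Q}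
    {e : Fin n × Fin n} :
    e ∈ differingEntries π z y ↔ e.1 ≠ e.2 ∧ π (z e.1) (z e.2) ≠ π (y e.1) (y e.2) := by
  simp [differingEntries]

/-- Among the vertices with a given label under `y`, some label under `z` is taken by a
proportion at least `1 / Q` of them. -/
theorem exists_plurality_label {n : ℕ} (hQ : 0 < Q) (z y : Fin n → Fin Q) (q : Fin Q) {m : ℝ}
    (hm : m ≤ ((Finset.univ.filter fun i => y i = q).card : ℝ)) :
    ∃ l, m / Q ≤ ((Finset.univ.filter fun i => y i = q ∧ z i = l).card : ℝ) := by
  have hQ' : (0 : ℝ) < Q := by exact_mod_cast hQ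
  have hcard : (Finset.univ.filter fun i => y i = q).card =
      ∑ l, (Finset.univ.filter fun i => y i = q ∧ z i = l).card := by
    rw [Finset.card_eq_sum_card_fiberwise (f := z) (t := Finset.univ) (by intro i _; simp)]
    simp [Finset.filter_filter]
  by_contra! h
  have : ∑ l, ((Finset.univ.filter fun i => y i = q ∧ z i = l).card : ℝ) <
      ∑ _l : Fin Q, m / Q :=
    Finset.sum_lt_sum_of_nonempty ⟨⟨0, hQ⟩, Finset.mem_univ _⟩ fun l _ => h l
  rw [← Nat.cast_sum, ← hcard, Finset.sum_const, Finset.card_univ, Fintype.card_fin,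
    nsmul_eq_mul, mul_div_cancel₀ _ hQ'.ne'] at this
  linarith

/-- If `f` preserves `π` and is taken by many vertices, then each vertex that disagrees with
`f ∘ y` contributes many differing entries. -/
theorem card_differingEntries_of_perm (π : Fin Q → Fin Q → unitInterval)
    (hA1 : ∀ q q' : Fin Q, q ≠ q' → ∃ l, π q l ≠ π q' l ∨ π l q ≠ π l q')
    {n : ℕ} (z y : Fin n → Fin Q) {σ : Equiv.Perm (Fin Q)} (hσ : σ ∈ invariantPerms π) {m : ℝ}
    (hm : ∀ q, m ≤ ((Finset.univ.filter fun i => y i = q ∧ z i = σ q).card : ℝ)) :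
    m * hammingDist z (fun i => σ (y i)) ≤ (differingEntries π z y).card := by
  classical
  set bad : Finset (Fin n) := {i | z i ≠ σ (y i)} with hbad
  -- Only pairs joining `i` to a vertex outside `bad` are kept. Such a pair has exactly one end in
  -- `bad`, so the sets `S i` are disjoint and their sizes add up.
  set S : Fin n → Finset (Fin n × Fin n) := fun i => (differingEntries π z y).filter fun e =>
    (e.1 = i ∧ e.2 ∉ bad) ∨ (e.2 = i ∧ e.1 ∉ bad) with hS
  have hσ' : ∀ q l, π (σ q) (σ l) = π q l := hσ
  have hSm : ∀ i ∈ bad, m ≤ ((S i).card : ℝ) := by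
    intro i hi
    have hi' : z i ≠ σ (y i) := by simpa [hbad] using hi
    obtain ⟨l', hl'⟩ := hA1 _ _ hi'
    obtain ⟨l, rfl⟩ := σ.surjective l'
    refine (hm l).trans (Nat.cast_le.2 ?_)
    -- By invariance `π (y i) l = π (σ (y i)) (σ l)`, so the label `σ l` that separates `z i` from
    -- `σ (y i)` makes every such `j` give a differing entry with `i`, in one of the two directions.
    have hgood : ∀ j ∈ Finset.univ.filter (fun j => y j = l ∧ z j = σ l),
        j ∉ bad ∧ j ≠ i ∧ y j = l ∧ z j = σ l := by
      intro j hj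
      obtain ⟨h1, h2⟩ : y j = l ∧ z j = σ l := by simpa using hj
      have hj' : j ∉ bad := by simp [hbad, h1, h2]
      exact ⟨hj', fun h => hj' (h ▸ hi), h1, h2⟩
    rcases hl' with h | h
    · refine Finset.card_le_card_of_injOn (fun j => (i, j)) ?_
        (fun a _ b _ hab => by simpa using hab)
      intro j hj
      obtain ⟨h0, h1, h2, h3⟩ := hgood j hj
      simp only [hS, Finset.coe_filter, Set.mem_ofPred_eq, mem_differingEntries]
      refine ⟨⟨h1.symm, ?_⟩, Or.inl ⟨trivial, h0⟩⟩
      rw [h3, h2, ← hσ' (y i) l]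
      exact h
    · refine Finset.card_le_card_of_injOn (fun j => (j, i)) ?_
        (fun a _ b _ hab => by simpa using hab)
      intro j hj
      obtain ⟨h0, h1, h2, h3⟩ := hgood j hj
      simp only [hS, Finset.coe_filter, Set.mem_ofPred_eq, mem_differingEntries]
      refine ⟨⟨h1, ?_⟩, Or.inr ⟨trivial, h0⟩⟩
      rw [h3, h2, ← hσ' l (y i)]
      exact h
  have hdisj : ∀ i ∈ bad, ∀ j ∈ bad, i ≠ j → Disjoint (S i) (S j) := by
    intro i hi j hj hij
    rw [Finset.disjoint_left]
    intro e he he'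
    simp only [hS, Finset.mem_filter] at he he'
    grind
  have hsub : bad.biUnion S ⊆ differingEntries π z y :=
    Finset.biUnion_subset.2 fun i _ => Finset.filter_subset _ _
  have hcard := Finset.card_le_card hsub
  rw [Finset.card_biUnion hdisj] at hcard
  have hd : hammingDist z (fun i => σ (y i)) = bad.card := rfl
  calc m * hammingDist z (fun i => σ (y i)) = ∑ _i ∈ bad, m := by
        rw [hd, Finset.sum_const, nsmul_eq_mul, mul_comm]
    _ ≤ ∑ i ∈ bad, ((S i).card : ℝ) := Finset.sum_le_sum hSm
    _ ≤ _ := by exact_mod_cast hcard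

/-- If all labels are frequent under `y`, then the number of differing entries of `z` and `y` is
at least of the order of `n` times the distance of `z` to a relabelling of `y`. -/
theorem exists_perm_hammingDist_le (π : Fin Q → Fin Q → unitInterval)
    (hA1 : ∀ q q' : Fin Q, q ≠ q' → ∃ l, π q l ≠ π q' l ∨ π l q ≠ π l q')
    (hQ : 0 < Q) {n : ℕ} (z y : Fin n → Fin Q) {γ : ℝ} (hγ : 0 < γ)
    (hy : ∀ q, γ * n ≤ ((Finset.univ.filter fun i => y i = q).card : ℝ))
    (hn : 2 ≤ γ / Q * n) :
    ∃ σ ∈ invariantPerms π, (γ / Q) ^ 2 / 2 * (n * hammingDist z (fun i => σ (y i))) ≤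
      ((differingEntries π z y).card : ℝ) := by
  classical
  have hQ' : (0 : ℝ) < Q := by exact_mod_cast hQ
  -- `f q` is a most common label under `z` among the vertices labelled `q` by `y`: the candidate
  -- relabelling. Either it preserves `π`, or a whole block of entries differs.
  choose f hf using fun q => exists_plurality_label hQ z y q (hy q)
  set η : ℝ := γ / Q with hη
  have hη0 : 0 < η := by positivity
  replace hf : ∀ q, η * n ≤ ((Finset.univ.filter fun i => y i = q ∧ z i = f q).card : ℝ) := by
    intro q
    have := hf q
    rwa [mul_div_right_comm] at this
  have hn0 : (0 : ℝ) < n := by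
    by_contra! h
    nlinarith
  have hle : ∀ q, ((Finset.univ.filter fun i => y i = q ∧ z i = f q).card : ℝ) ≤ n := by
    intro q
    exact_mod_cast (Finset.card_le_univ _).trans (by simp)
  -- This gives `η ^ 2 / 2 ≤ η`, so that one constant serves both cases below.
  have hη1 : η ≤ 1 := by
    have := (hf ⟨0, hQ⟩).trans (hle ⟨0, hQ⟩)
    by_contra! h
    nlinarith
  by_cases hinv : ∀ q l, π (f q) (f l) = π q l
  · have hinj : Function.Injective f := by
      intro q q' hqq'
      by_contra hne
      obtain ⟨l, hl | hl⟩ := hA1 q q' hne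
      · exact hl (by rw [← hinv q l, ← hinv q' l, hqq'])
      · exact hl (by rw [← hinv l q, ← hinv l q', hqq'])
    let σ : Equiv.Perm (Fin Q) := Equiv.ofBijective f (Finite.injective_iff_bijective.1 hinj)
    have hσ : σ ∈ invariantPerms π := hinv
    refine ⟨σ, hσ, le_trans ?_ (card_differingEntries_of_perm π hA1 z y hσ (m := η * n) hf)⟩
    have : (0 : ℝ) ≤ n * hammingDist z (fun i => σ (y i)) := by positivity
    rw [mul_assoc]
    exact mul_le_mul_of_nonneg_right (by nlinarith) this
  · push Not at hinv
    obtain ⟨q, l, hql⟩ := hinv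
    refine ⟨1, fun _ _ => rfl, ?_⟩
    set Gq := Finset.univ.filter fun i => y i = q ∧ z i = f q
    set Gl := Finset.univ.filter fun i => y i = l ∧ z i = f l
    -- A pair `(q, l)` on which `f` fails to preserve `π` makes all of `Gq ×ˢ Gl` differ, apart from
    -- diagonal entries. That is of order `n ^ 2`, which beats `n` times any Hamming distance, so
    -- the identity serves as `σ`.
    have hsub : Gq ×ˢ Gl ⊆ differingEntries π z y ∪ Gq.image fun i => (i, i) := by
      rintro ⟨i, j⟩ he
      obtain ⟨⟨h1, h2⟩, h3, h4⟩ : (y i = q ∧ z i = f q) ∧ y j = l ∧ z j = f l := by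
        simpa [Gq, Gl] using he
      rw [Finset.mem_union, mem_differingEntries]
      by_cases hij : i = j
      · right
        simp [Gq, h1, h2, hij.symm]
      · left
        refine ⟨hij, ?_⟩
        simpa [h1, h2, h3, h4] using hql
    have hcard := (Finset.card_le_card hsub).trans ((Finset.card_union_le _ _).trans
      (Nat.add_le_add_left Finset.card_image_le _))
    rw [Finset.card_product] at hcard
    have hcard' : (Gq.card : ℝ) * Gl.card ≤ (differingEntries π z y).card + Gq.card := by
      exact_mod_cast hcard
    have h1 := hf q
    have h2 := hf l
    have hd : (hammingDist z (fun i => (1 : Equiv.Perm (Fin Q)) (y i)) : ℝ) ≤ n := by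
      exact_mod_cast hammingDist_le_card_fintype.trans (by simp)
    -- The diagonal removes at most `Gq.card` pairs, and `2 ≤ η * n` gives `η * n - 1 ≥ η * n / 2`.
    have h3 : (η * n) * (η * n / 2) ≤ Gq.card * (Gl.card - 1 : ℝ) :=
      mul_le_mul h1 (by linarith) (by positivity) (by positivity)
    calc η ^ 2 / 2 * (n * hammingDist z (fun i => (1 : Equiv.Perm (Fin Q)) (y i)))
        ≤ η ^ 2 / 2 * (n * n) := by gcongr
      _ = (η * n) * (η * n / 2) := by ring
      _ ≤ _ := by linarith

/-! ### Generating function of the Hamming distance. -/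

/-- The sum of `t ^ d(z, y)` over all label vectors `z`, where `d` is the Hamming distance. -/
theorem sum_pow_hammingDist_le {n : ℕ} (y : Fin n → Fin Q) (t : ℝ) (ht : 0 ≤ t) :
    ∑ z, t ^ hammingDist z y ≤ (1 + Q * t) ^ n := by
  classical
  have h1 : ∀ z : Fin n → Fin Q, t ^ hammingDist z y = ∏ i, if z i = y i then 1 else t := by
    intro z
    rw [Finset.prod_ite]
    simp [hammingDist]
  simp_rw [h1]
  -- The weight is a product over coordinates, so the sum over vectors factorizes.
  have h2 := Finset.prod_univ_sum (fun _ : Fin n => (Finset.univ : Finset (Fin Q)))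
    (fun i q => if q = y i then (1 : ℝ) else t)
  rw [Fintype.piFinset_univ] at h2
  rw [← h2]
  calc ∏ i : Fin n, ∑ q, (if q = y i then (1 : ℝ) else t)
      ≤ ∏ _i : Fin n, (1 + Q * t) := by
        refine Finset.prod_le_prod (fun i _ => Finset.sum_nonneg fun q _ => by
          split_ifs <;> linarith) fun i _ => ?_
        calc ∑ q, (if q = y i then (1 : ℝ) else t)
            ≤ ∑ q, ((if q = y i then (1 : ℝ) else 0) + t) :=
              Finset.sum_le_sum fun q _ => by split_ifs <;> linarith
          _ = 1 + Q * t := by simp [Finset.sum_add_distrib]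
    _ = _ := by simp

/-- Dropping `z = y` removes the term `1`; then `(1 + Q t) ^ n ≤ exp s` with `s = n Q t`, and `exp s
- 1 ≤ 2 s` for `0 ≤ s ≤ 1`. -/
theorem sum_pow_hammingDist_ne_le {n : ℕ} (y : Fin n → Fin Q) (t : ℝ) (ht : 0 ≤ t)
    (hnt : n * (Q * t) ≤ 1) :
    ∑ z with z ≠ y, t ^ hammingDist z y ≤ 2 * (n * (Q * t)) := by
  classical
  have h1 := sum_pow_hammingDist_le y t ht
  have h2 : ∑ z, t ^ hammingDist z y = 1 + ∑ z with z ≠ y, t ^ hammingDist z y := by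
    rw [← Finset.sum_filter_add_sum_filter_not Finset.univ (fun z => z = y),
      Finset.filter_eq' Finset.univ y]
    simp
  have h0 : 0 ≤ n * (Q * t) := by positivity
  have h3 : (1 + Q * t) ^ n ≤ Real.exp (n * (Q * t)) := by
    rw [Real.exp_nat_mul]
    have : 0 ≤ Q * t := by positivity
    gcongr
    linarith [Real.add_one_le_exp (Q * t)]
  have h4 := Real.abs_exp_sub_one_le (x := n * (Q * t)) (by rwa [abs_of_nonneg h0])
  rw [abs_of_nonneg h0] at h4
  linarith [le_abs_self (Real.exp (n * (Q * t)) - 1)]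

/-! ### Square roots of likelihood ratios and Bhattacharyya affinities. -/

/-- The square root of the likelihood ratio of the label vectors `z` and `y`, with the convention
`0 / 0 = 0` for each entry. -/
def rootRatio (π : Fin Q → Fin Q → unitInterval) (n : ℕ) (z y : Fin n → Fin Q)
    (x : Adjacency) : ℝ≥0 :=
  ∏ e : Fin n × Fin n, NNReal.sqrt (entryMass π (e.1, e.2) (z e.1) (z e.2) (x (e.1, e.2)) /
    entryMass π (e.1, e.2) (y e.1) (y e.2) (x (e.1, e.2)))

theorem rootRatio_sq (π : Fin Q → Fin Q → unitInterval) (n : ℕ) (z y : Fin n → Fin Q)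
    (x : Adjacency) :
    rootRatio π n z y x ^ 2 = likelihood π n z x / likelihood π n y x := by
  rw [rootRatio, ← Finset.prod_pow, likelihood, likelihood, ← Finset.prod_div_distrib]
  simp

theorem measurable_rootRatio (π : Fin Q → Fin Q → unitInterval) (n : ℕ) (z y : Fin n → Fin Q) :
    Measurable (rootRatio π n z y) := by
  refine Finset.measurable_fun_prod _ fun e _ => ?_
  exact (Measurable.of_discrete (f := fun b => NNReal.sqrt
    (entryMass π (e.1, e.2) (z e.1) (z e.2) b / entryMass π (e.1, e.2) (y e.1) (y e.2) b))).comp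
    (measurable_pi_apply ((e.1 : ℕ), (e.2 : ℕ)))

theorem lintegral_entry (π : Fin Q → Fin Q → unitInterval) (zs : Labels Q) (e : ℕ × ℕ)
    (f : Bool → ℝ≥0) :
    ∫⁻ x, f (x e) ∂(edgeLaw π zs) =
      ((∑ b, f b * entryMass π e (zs e.1) (zs e.2) b : ℝ≥0) : ℝ≥0∞) := by
  have hmp := measurePreserving_eval_infinitePi
    (fun e : ℕ × ℕ => entryLaw π e (zs e.1) (zs e.2)) e
  have := hmp.lintegral_comp (f := fun b => (f b : ℝ≥0∞)) Measurable.of_discrete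
  refine Eq.trans this ?_
  rw [lintegral_fintype]
  push_cast
  simp_rw [coe_entryMass]

theorem sum_entryMass (π : Fin Q → Fin Q → unitInterval) (e : ℕ × ℕ) (q l : Fin Q) :
    ∑ b, entryMass π e q l b = 1 := by
  rw [← ENNReal.coe_inj]
  push_cast
  simp_rw [coe_entryMass]
  rw [sum_measure_singleton, Finset.coe_univ, measure_univ]

theorem entryMass_true (π : Fin Q → Fin Q → unitInterval) {e : ℕ × ℕ} (he : e.1 ≠ e.2)
    (q l : Fin Q) : (entryMass π e q l true : ℝ) = π q l := by
  simp [entryMass, entryLaw, he]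

theorem nnreal_sqrt_mul_le (a b : ℝ≥0) : 2 * NNReal.sqrt (a * b) ≤ a + b := by
  rw [NNReal.sqrt_mul]
  have := two_mul_le_add_sq (NNReal.sqrt a) (NNReal.sqrt b)
  simpa [mul_assoc] using this

theorem nnreal_sqrt_mul_lt {a b : ℝ≥0} (hab : a ≠ b) : 2 * NNReal.sqrt (a * b) < a + b := by
  refine lt_of_le_of_ne (nnreal_sqrt_mul_le a b) fun h => hab ?_
  have h1 : 4 * (a * b) = (a + b) ^ 2 := by
    rw [← h, mul_pow, NNReal.sq_sqrt]; norm_num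
  have h2 : ((a : ℝ) - b) ^ 2 = 0 := by
    have := congrArg ((↑) : ℝ≥0 → ℝ) h1
    push_cast at this
    linarith
  have h3 := pow_eq_zero_iff (two_ne_zero) |>.1 h2
  exact NNReal.coe_injective (by linarith)

/-- The Bhattacharyya affinity of two laws of an entry. -/
def affinity (π : Fin Q → Fin Q → unitInterval) (e : ℕ × ℕ) (q l q' l' : Fin Q) : ℝ≥0 :=
  ∑ b, NNReal.sqrt (entryMass π e q l b * entryMass π e q' l' b)

theorem affinity_le_one (π : Fin Q → Fin Q → unitInterval) (e : ℕ × ℕ) (q l q' l' : Fin Q) :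
    affinity π e q l q' l' ≤ 1 := by
  have h : 2 * affinity π e q l q' l' ≤ 2 * 1 := by
    calc 2 * affinity π e q l q' l'
        ≤ ∑ b, (entryMass π e q l b + entryMass π e q' l' b) := by
          rw [affinity, Finset.mul_sum]
          exact Finset.sum_le_sum fun b _ => nnreal_sqrt_mul_le _ _
      _ = 2 * 1 := by rw [Finset.sum_add_distrib, sum_entryMass, sum_entryMass]; norm_num
  exact le_of_mul_le_mul_left h two_pos

theorem affinity_lt_one (π : Fin Q → Fin Q → unitInterval) {e : ℕ × ℕ} (he : e.1 ≠ e.2)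
    {q l q' l' : Fin Q} (h : π q l ≠ π q' l') : affinity π e q l q' l' < 1 := by
  have hne : entryMass π e q l true ≠ entryMass π e q' l' true := by
    intro h'
    apply h
    apply Subtype.ext
    rw [← entryMass_true π he q l, h', entryMass_true π he]
  have h : 2 * affinity π e q l q' l' < 2 * 1 := by
    calc 2 * affinity π e q l q' l'
        < ∑ b, (entryMass π e q l b + entryMass π e q' l' b) := by
          rw [affinity, Finset.mul_sum]
          exact Finset.sum_lt_sum (fun b _ => nnreal_sqrt_mul_le _ _)
            ⟨true, Finset.mem_univ _, nnreal_sqrt_mul_lt hne⟩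
      _ = 2 * 1 := by rw [Finset.sum_add_distrib, sum_entryMass, sum_entryMass]; norm_num
  exact lt_of_mul_lt_mul_left h zero_le_two

theorem affinity_congr (π : Fin Q → Fin Q → unitInterval) {e e' : ℕ × ℕ} (he : e.1 ≠ e.2)
    (he' : e'.1 ≠ e'.2) (q l q' l' : Fin Q) :
    affinity π e q l q' l' = affinity π e' q l q' l' := by
  simp [affinity, entryMass, entryLaw, he, he']

/-- Off the diagonal the affinity does not depend on the entry, so finitely many numbers below `1`
have to be dominated. Positivity of `ρ` is for comparing its real powers later. -/
theorem exists_affinity_le (π : Fin Q → Fin Q → unitInterval) :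
    ∃ ρ : ℝ≥0, 0 < ρ ∧ ρ < 1 ∧ ∀ (e : ℕ × ℕ) (q l q' l' : Fin Q), e.1 ≠ e.2 →
      π q l ≠ π q' l' → affinity π e q l q' l' ≤ ρ := by
  have h : ∀ᶠ ρ : ℝ≥0 in 𝓝[<] 1, ∀ a : Fin Q × Fin Q × Fin Q × Fin Q,
      π a.1 a.2.1 ≠ π a.2.2.1 a.2.2.2 →
        affinity π (0, 1) a.1 a.2.1 a.2.2.1 a.2.2.2 ≤ ρ := by
    rw [eventually_all]
    intro a
    by_cases ha : π a.1 a.2.1 = π a.2.2.1 a.2.2.2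
    · exact Eventually.of_forall fun ρ h => absurd ha h
    · filter_upwards [Ioo_mem_nhdsLT (affinity_lt_one π (e := (0, 1)) (by simp) ha)] with ρ hρ _
      exact hρ.1.le
  have : (𝓝[<] (1 : ℝ≥0)).NeBot := nhdsLT_neBot_of_exists_lt ⟨0, zero_lt_one⟩
  obtain ⟨ρ, hρ, h0, h1⟩ := (h.and (Ioo_mem_nhdsLT (zero_lt_one' ℝ≥0))).exists
  refine ⟨ρ, h0, h1, fun e q l q' l' he hne => ?_⟩
  rw [affinity_congr π he (e' := (0, 1)) (by simp)]
  exact hρ (q, l, q', l') hne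

/-- With `m` the true mass, `√(p / m) * m = √(p * m)`; at `m = 0` both sides vanish, so
deterministic entries do no harm. -/
theorem lintegral_rootRatio_entry_le (π : Fin Q → Fin Q → unitInterval) (zs : Labels Q)
    (e : ℕ × ℕ) (q l : Fin Q) :
    ∫⁻ x, (NNReal.sqrt (entryMass π e q l (x e) / entryMass π e (zs e.1) (zs e.2) (x e)) : ℝ≥0)
      ∂(edgeLaw π zs) ≤ affinity π e q l (zs e.1) (zs e.2) := by
  rw [lintegral_entry π zs e fun b =>
    NNReal.sqrt (entryMass π e q l b / entryMass π e (zs e.1) (zs e.2) b)]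
  refine ENNReal.coe_le_coe.2 (Finset.sum_le_sum fun b _ => ?_)
  set m := entryMass π e (zs e.1) (zs e.2) b
  rcases eq_or_ne m 0 with hm | hm
  · simp [hm]
  · refine le_of_eq ?_
    rw [NNReal.sqrt_div, NNReal.sqrt_mul]
    have h : NNReal.sqrt m ≠ 0 := by simpa using hm
    field_simp
    simp

/-- The expectation under `P*` of the square root of the likelihood ratio. -/
theorem lintegral_rootRatio_le (π : Fin Q → Fin Q → unitInterval) {ρ : ℝ≥0}
    (hρ : ∀ (e : ℕ × ℕ) (q l q' l' : Fin Q), e.1 ≠ e.2 →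
      π q l ≠ π q' l' → affinity π e q l q' l' ≤ ρ)
    (zs : Labels Q) (n : ℕ) (z : Fin n → Fin Q) :
    ∫⁻ x, rootRatio π n z (labelsUpTo n zs) x ∂(edgeLaw π zs) ≤
      ((ρ ^ (differingEntries π z (labelsUpTo n zs)).card : ℝ≥0) : ℝ≥0∞) := by
  classical
  set g : Fin n × Fin n → Bool → ℝ≥0∞ := fun e b =>
    (NNReal.sqrt (entryMass π (e.1, e.2) (z e.1) (z e.2) b /
      entryMass π (e.1, e.2) (zs e.1) (zs e.2) b) : ℝ≥0)
  have hcoord : iIndepFun (fun (e : ℕ × ℕ) (x : Adjacency) => x e) (edgeLaw π zs) :=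
    iIndepFun_infinitePi (X := fun _ b => b) (fun _ => measurable_id)
  have hind : iIndepFun (fun (e : Fin n × Fin n) (x : Adjacency) => g e (x (e.1, e.2)))
      (edgeLaw π zs) :=
    (hcoord.precomp (edgeEmbedding n).injective).comp g fun _ => Measurable.of_discrete
  have hmeas : ∀ e : Fin n × Fin n, Measurable fun x : Adjacency => g e (x (e.1, e.2)) :=
    fun e => (Measurable.of_discrete (f := g e)).comp (measurable_pi_apply _)
  have hprod : ∀ x, (rootRatio π n z (labelsUpTo n zs) x : ℝ≥0∞) =
      ∏ e : Fin n × Fin n, g e (x (e.1, e.2)) := by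
    intro x
    simp only [rootRatio, labelsUpTo, g]
    push_cast
    rfl
  simp_rw [hprod]
  -- Independence of the entries under `P*`: differing entries contribute at most `ρ`, all others,
  -- the diagonal included, at most `1`.
  rw [lintegral_prod_eq_prod_lintegral_of_indepFun Finset.univ _ hind hmeas]
  calc ∏ e : Fin n × Fin n, ∫⁻ x, g e (x (e.1, e.2)) ∂(edgeLaw π zs)
      ≤ ∏ e : Fin n × Fin n,
          ((if e ∈ differingEntries π z (labelsUpTo n zs) then ρ else 1 : ℝ≥0) : ℝ≥0∞) := by
        refine Finset.prod_le_prod' fun e _ => ?_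
        refine (lintegral_rootRatio_entry_le π zs (e.1, e.2) (z e.1) (z e.2)).trans ?_
        refine ENNReal.coe_le_coe.2 ?_
        split_ifs with he
        · rw [mem_differingEntries] at he
          exact hρ _ _ _ _ _ (fun h => he.1 (Fin.ext h)) he.2
        · exact affinity_le_one _ _ _ _ _ _
    _ = _ := by
        rw [← ENNReal.ofNNReal_finsetProd, Finset.prod_ite_mem]
        simp

/-! ### From the divergence to the posterior odds. -/

theorem prior_div_le {α : stdSimplex ℝ (Fin Q)} {γ : ℝ≥0} (hγ : 0 < γ)
    (hα : ∀ q, γ ≤ (α q).toNNReal) {n : ℕ} (z y : Fin n → Fin Q) :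
    prior α z / prior α y ≤ γ⁻¹ ^ hammingDist z y := by
  classical
  have hα1 : ∀ q, (α q).toNNReal ≤ 1 := by
    intro q
    rw [Real.toNNReal_le_one]
    have h : ∑ q, α q = 1 := α.2.2
    rw [← h]
    exact Finset.single_le_sum (f := fun q => α q) (fun q _ => α.2.1 q) (Finset.mem_univ q)
  rw [prior, prior, ← Finset.prod_div_distrib]
  calc ∏ i, (α (z i)).toNNReal / (α (y i)).toNNReal
      ≤ ∏ i, if z i = y i then 1 else γ⁻¹ := by
        refine Finset.prod_le_prod' fun i _ => ?_
        split_ifs with h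
        · rw [h]; exact div_self_le_one _
        · rw [← one_div]
          exact div_le_div₀ zero_le_one (hα1 _) hγ (hα _)
    _ = _ := by
        rw [Finset.prod_ite]
        simp [hammingDist]

theorem prior_pos {α : stdSimplex ℝ (Fin Q)} {γ : ℝ≥0} (hγ : 0 < γ)
    (hα : ∀ q, γ ≤ (α q).toNNReal) {n : ℕ} (z : Fin n → Fin Q) : 0 < prior α z :=
  Finset.prod_pos fun _ _ => hγ.trans_le (hα _)

theorem likelihood_perm {π : Fin Q → Fin Q → unitInterval} {σ : Equiv.Perm (Fin Q)}
    (hσ : σ ∈ invariantPerms π) (n : ℕ) (y : Fin n → Fin Q) (x : Adjacency) :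
    likelihood π n (fun i => σ (y i)) x = likelihood π n y x := by
  have hσ' : ∀ q l, π (σ q) (σ l) = π q l := hσ
  simp [likelihood, entryMass, entryLaw, hσ']

/-- The label vectors that are equivalent to `y`. -/
def labelClassFinset (π : Fin Q → Fin Q → unitInterval) {n : ℕ} (y : Fin n → Fin Q) :
    Finset (Fin n → Fin Q) := by
  classical
  exact {z | labelSetoid π n z y}

theorem mem_labelClassFinset {π : Fin Q → Fin Q → unitInterval} {n : ℕ} {z y : Fin n → Fin Q} :
    z ∈ labelClassFinset π y ↔ labelSetoid π n z y := by
  simp [labelClassFinset]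

theorem perm_mem_labelClassFinset {π : Fin Q → Fin Q → unitInterval} {n : ℕ}
    {y : Fin n → Fin Q} {σ : Equiv.Perm (Fin Q)} (hσ : σ ∈ invariantPerms π) :
    (fun i => σ (y i)) ∈ labelClassFinset π y :=
  mem_labelClassFinset.2 ((labelSetoid π n).symm ⟨σ, hσ, fun _ => rfl⟩)

/-- The divergence from the posterior distribution is at most the posterior odds against the class
of any label vector `y`. -/
theorem minKL_le_odds (α : stdSimplex ℝ (Fin Q)) (π : Fin Q → Fin Q → unitInterval) (n : ℕ)
    (x : Adjacency) (y : Fin n → Fin Q) (hy : 0 < prior α y * likelihood π n y x) :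
    minKL α π n x ≤ (((∑ z ∈ (labelClassFinset π y)ᶜ, prior α z * likelihood π n z x) /
      ∑ z ∈ labelClassFinset π y, prior α z * likelihood π n z x : ℝ≥0) : ℝ≥0∞) := by
  set w : (Fin n → Fin Q) → ℝ≥0 := fun z => prior α z * likelihood π n z x with hw
  set A : ℝ≥0 := ∑ z ∈ labelClassFinset π y, w z with hA
  set B : ℝ≥0 := ∑ z ∈ (labelClassFinset π y)ᶜ, w z with hB
  have hApos : 0 < A := hy.trans_le
    (Finset.single_le_sum (f := w) (fun _ _ => zero_le)
      (mem_labelClassFinset.2 ((labelSetoid π n).refl y)))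
  have hAB : ∑ z, w z = A + B := (Finset.sum_add_sum_compl _ _).symm
  have hABpos : 0 < A + B := hApos.trans_le le_self_add
  set c : LabelClass π n := Quotient.mk (labelSetoid π n) y
  have hpost : ∀ S : Finset (Fin n → Fin Q),
      posterior α π n x S = (((A + B)⁻¹ * ∑ z ∈ S, w z : ℝ≥0) : ℝ≥0∞) := by
    intro S
    rw [posterior_apply, hAB, ENNReal.coe_mul, ENNReal.coe_inv hABpos.ne']
  have hprob : IsProbabilityMeasure (posterior α π n x) := by
    constructor
    rw [← Finset.coe_univ, hpost, hAB, inv_mul_cancel₀ hABpos.ne', ENNReal.coe_one]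
  have hmk := measurable_labelClass_mk π n
  have hprob' : IsProbabilityMeasure (classLaw π (posterior α π n x)) :=
    Measure.isProbabilityMeasure_map hmk.aemeasurable
  have hc : classLaw π (posterior α π n x) {c} = (((A + B)⁻¹ * A : ℝ≥0) : ℝ≥0∞) := by
    have hpre : Quotient.mk (labelSetoid π n) ⁻¹' {c} = (labelClassFinset π y : Set _) := by
      ext z
      simp only [Set.mem_preimage, Set.mem_singleton_iff, Finset.mem_coe, mem_labelClassFinset]
      exact Quotient.eq
    rw [classLaw, Measure.map_apply hmk (measurableSet_singleton _), hpre, hpost]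
  have hcpos : 0 < (A + B)⁻¹ * A := mul_pos (inv_pos.2 hABpos) hApos
  obtain ⟨τ, hτ⟩ := productMultinomial_vertex y
  have hdirac : classLaw π (Measure.dirac y) = Measure.dirac c := Measure.map_dirac' hmk y
  calc minKL α π n x
      ≤ InformationTheory.klDiv (classLaw π (productMultinomial τ))
          (classLaw π (posterior α π n x)) := iInf₂_le _ ⟨τ, rfl⟩
    _ = ENNReal.ofReal (-Real.log ((classLaw π (posterior α π n x)).real {c})) := by
        rw [hτ, hdirac, klDiv_dirac_eq]
        rw [hc]
        exact_mod_cast hcpos.ne'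
    _ ≤ ENNReal.ofReal ((B / A : ℝ≥0) : ℝ) := by
        -- The class has mass `p = A / (A + B)`, and `log (1 / p) ≤ 1 / p - 1 = B / A`.
        refine ENNReal.ofReal_le_ofReal ?_
        rw [measureReal_def, hc, ENNReal.coe_toReal, ← Real.log_inv]
        have hA' : (0 : ℝ) < A := hApos
        have hB' : (0 : ℝ) ≤ B := B.2
        refine (Real.log_le_sub_one_of_pos (by positivity)).trans (le_of_eq ?_)
        push_cast
        field_simp
        ring
    _ = _ := ENNReal.ofReal_coe_nnreal

/-- The posterior odds against the class of `y` are at most the square of a sum of square roots of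
likelihood ratios, where each `z` is compared with the relabelling `σ z ∘ y` of `y`. -/
theorem odds_le_sq {α : stdSimplex ℝ (Fin Q)} (π : Fin Q → Fin Q → unitInterval) {γ : ℝ≥0}
    (hγ : 0 < γ) (hα : ∀ q, γ ≤ (α q).toNNReal) (n : ℕ) (x : Adjacency) (y : Fin n → Fin Q)
    (hy : 0 < likelihood π n y x) (σ : (Fin n → Fin Q) → Equiv.Perm (Fin Q))
    (hσ : ∀ z, σ z ∈ invariantPerms π) :
    (∑ z ∈ (labelClassFinset π y)ᶜ, prior α z * likelihood π n z x) /
      ∑ z ∈ labelClassFinset π y, prior α z * likelihood π n z x ≤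
    (∑ z ∈ (labelClassFinset π y)ᶜ,
      NNReal.sqrt γ⁻¹ ^ hammingDist z (fun i => σ z (y i)) * rootRatio π n z y x) ^ 2 := by
  rw [Finset.sum_div]
  refine le_trans (Finset.sum_le_sum fun z _ => ?_)
    (Finset.sum_sq_le_sq_sum_of_nonneg fun _ _ => zero_le)
  -- Of the denominator only the term `y'` is kept. It has the likelihood of `y`, while its prior is
  -- compared with that of `z` through the distance from `z` to `y'`, the one that also bounds the
  -- number of differing entries.
  set y' : Fin n → Fin Q := fun i => σ z (y i) with hy'
  have hlik : likelihood π n y' x = likelihood π n y x := likelihood_perm (hσ z) n y x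
  have hpos : 0 < prior α y' * likelihood π n y' x := by
    rw [hlik]; exact mul_pos (prior_pos hγ hα _) hy
  calc prior α z * likelihood π n z x /
        ∑ z ∈ labelClassFinset π y, prior α z * likelihood π n z x
      ≤ prior α z * likelihood π n z x / (prior α y' * likelihood π n y' x) := by
        refine div_le_div_of_nonneg_left zero_le hpos ?_
        exact Finset.single_le_sum (f := fun z => prior α z * likelihood π n z x)
          (fun _ _ => zero_le) (perm_mem_labelClassFinset (hσ z))
    _ = prior α z / prior α y' * (likelihood π n z x / likelihood π n y x) := by
        rw [hlik, mul_div_mul_comm]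
    _ ≤ γ⁻¹ ^ hammingDist z y' * rootRatio π n z y x ^ 2 := by
        rw [rootRatio_sq]
        exact mul_le_mul_of_nonneg_right (prior_div_le hγ hα z y') zero_le
    _ = _ := by
        rw [mul_pow, ← pow_mul, mul_comm _ 2, pow_mul, NNReal.sq_sqrt]

/-- Parameters may be `0` or `1`, but each of the countably many entries almost surely avoids values
of mass zero under its own law. -/
theorem ae_likelihood_pos (π : Fin Q → Fin Q → unitInterval) (zs : Labels Q) :
    ∀ᵐ x ∂(edgeLaw π zs), ∀ n, 0 < likelihood π n (labelsUpTo n zs) x := by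
  have h : ∀ᵐ x ∂(edgeLaw π zs), ∀ e : ℕ × ℕ, 0 < entryMass π e (zs e.1) (zs e.2) (x e) := by
    rw [ae_all_iff]
    intro e
    have hlin := lintegral_entry π zs e
      fun b => if entryMass π e (zs e.1) (zs e.2) b = 0 then 1 else 0
    have hzero : ∑ b, (if entryMass π e (zs e.1) (zs e.2) b = 0 then (1 : ℝ≥0) else 0) *
        entryMass π e (zs e.1) (zs e.2) b = 0 :=
      Finset.sum_eq_zero fun b _ => by split_ifs with h <;> simp [h]
    rw [hzero, ENNReal.coe_zero, lintegral_eq_zero_iff] at hlin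
    · filter_upwards [hlin] with x hx
      rw [pos_iff_ne_zero]
      intro h0
      simp [h0] at hx
    · exact (Measurable.of_discrete (f := fun b =>
        ((if entryMass π e (zs e.1) (zs e.2) b = 0 then 1 else 0 : ℝ≥0) : ℝ≥0∞))).comp
        (measurable_pi_apply e)
  filter_upwards [h] with x hx n
  exact Finset.prod_pos fun e _ => hx (e.1, e.2)

/-! ### Expectation of the sum of root likelihood ratios. -/

/-- If each `z` not equivalent to `y` is compared with a relabelling of `y`, the powers of the
distances have a small sum. -/
theorem sum_compl_pow_hammingDist_le {n : ℕ} (π : Fin Q → Fin Q → unitInterval)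
    (y : Fin n → Fin Q) (σ : (Fin n → Fin Q) → Equiv.Perm (Fin Q))
    (hσ : ∀ z, σ z ∈ invariantPerms π) (t : ℝ) (ht : 0 ≤ t) (hnt : n * (Q * t) ≤ 1) :
    ∑ z ∈ (labelClassFinset π y)ᶜ, t ^ hammingDist z (fun i => σ z (y i)) ≤
      Fintype.card (Equiv.Perm (Fin Q)) * (2 * (n * (Q * t))) := by
  classical
  calc ∑ z ∈ (labelClassFinset π y)ᶜ, t ^ hammingDist z (fun i => σ z (y i))
      ≤ ∑ z ∈ (labelClassFinset π y)ᶜ, ∑ s : Equiv.Perm (Fin Q),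
          if z ≠ (fun i => s (y i)) then t ^ hammingDist z (fun i => s (y i)) else 0 := by
        refine Finset.sum_le_sum fun z hz => ?_
        -- Outside the class, `z` differs from every admissible relabelling, so the term with
        -- distance `0` never occurs. The dependence of `σ` on `z` is removed by summing over all
        -- permutations.
        have hne : z ≠ fun i => σ z (y i) := by
          intro h
          refine Finset.mem_compl.1 hz ?_
          rw [h]
          exact perm_mem_labelClassFinset (hσ z)
        refine le_trans (le_of_eq ?_) (Finset.single_le_sum (f := fun s : Equiv.Perm (Fin Q) =>
          if z ≠ (fun i => s (y i)) then t ^ hammingDist z (fun i => s (y i)) else 0)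
          (fun s _ => ?_) (Finset.mem_univ (σ z)))
        · exact (if_pos hne).symm
        · split_ifs <;> positivity
    _ ≤ ∑ z, ∑ s : Equiv.Perm (Fin Q),
          if z ≠ (fun i => s (y i)) then t ^ hammingDist z (fun i => s (y i)) else 0 :=
        Finset.sum_le_sum_of_subset_of_nonneg (Finset.subset_univ _) fun z _ _ =>
          Finset.sum_nonneg fun s _ => by split_ifs <;> positivity
    _ = ∑ s : Equiv.Perm (Fin Q), ∑ z with z ≠ (fun i => s (y i)),
          t ^ hammingDist z (fun i => s (y i)) := by
        rw [Finset.sum_comm]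
        exact Finset.sum_congr rfl fun s _ => (Finset.sum_filter _ _).symm
    _ ≤ ∑ _s : Equiv.Perm (Fin Q), 2 * (n * (Q * t)) :=
        Finset.sum_le_sum fun s _ => sum_pow_hammingDist_ne_le _ t ht hnt
    _ = _ := by rw [Finset.sum_const, Finset.card_univ, nsmul_eq_mul]

/-- The sum of square roots of likelihood ratios that controls the posterior odds against the class
of `y`. -/
def rootOdds (π : Fin Q → Fin Q → unitInterval) (β : ℝ≥0) {n : ℕ} (y : Fin n → Fin Q)
    (σ : (Fin n → Fin Q) → Equiv.Perm (Fin Q)) (x : Adjacency) : ℝ≥0 :=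
  ∑ z ∈ (labelClassFinset π y)ᶜ,
    β ^ hammingDist z (fun i => σ z (y i)) * rootRatio π n z y x

theorem measurable_rootOdds (π : Fin Q → Fin Q → unitInterval) (β : ℝ≥0) {n : ℕ}
    (y : Fin n → Fin Q) (σ : (Fin n → Fin Q) → Equiv.Perm (Fin Q)) :
    Measurable (rootOdds π β y σ) :=
  Finset.measurable_fun_sum _ fun z _ => (measurable_rootRatio π n z y).const_mul _

/-- Since `ρ < 1`, `hd` bounds the expected term of `z` by `β ^ d * ρ ^ (c * n * d) = t ^ d` with `t
= β * (ρ ^ c) ^ n`; the Hamming sum does the rest. -/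
theorem lintegral_rootOdds_le (π : Fin Q → Fin Q → unitInterval) {ρ : ℝ≥0} (hρ0 : 0 < ρ)
    (hρ1 : ρ < 1)
    (hρ : ∀ (e : ℕ × ℕ) (q l q' l' : Fin Q), e.1 ≠ e.2 →
      π q l ≠ π q' l' → affinity π e q l q' l' ≤ ρ)
    (zs : Labels Q) (β : ℝ≥0) (c : ℝ) (n : ℕ)
    (σ : (Fin n → Fin Q) → Equiv.Perm (Fin Q)) (hσ : ∀ z, σ z ∈ invariantPerms π)
    (hd : ∀ z, c * (n * hammingDist z (fun i => σ z (labelsUpTo n zs i))) ≤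
      ((differingEntries π z (labelsUpTo n zs)).card : ℝ))
    (hn : n * (Q * ((β * (ρ ^ c) ^ n : ℝ≥0) : ℝ)) ≤ 1) :
    ∫⁻ x, rootOdds π β (labelsUpTo n zs) σ x ∂(edgeLaw π zs) ≤
      ENNReal.ofReal (Fintype.card (Equiv.Perm (Fin Q)) *
        (2 * (n * (Q * ((β * (ρ ^ c) ^ n : ℝ≥0) : ℝ))))) := by
  set y := labelsUpTo n zs
  set t : ℝ≥0 := β * (ρ ^ c) ^ n with ht
  calc ∫⁻ x, rootOdds π β y σ x ∂(edgeLaw π zs)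
      = ∑ z ∈ (labelClassFinset π y)ᶜ, ((β ^ hammingDist z (fun i => σ z (y i)) : ℝ≥0) : ℝ≥0∞) *
          ∫⁻ x, rootRatio π n z y x ∂(edgeLaw π zs) := by
        simp only [rootOdds, ENNReal.ofNNReal_finsetSum, ENNReal.coe_mul]
        rw [lintegral_finsetSum _ fun z _ =>
          (measurable_rootRatio π n z y).coe_nnreal_ennreal.const_mul _]
        exact Finset.sum_congr rfl fun z _ =>
          lintegral_const_mul _ (measurable_rootRatio π n z y).coe_nnreal_ennreal
    _ ≤ ∑ z ∈ (labelClassFinset π y)ᶜ,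
          ((t ^ hammingDist z (fun i => σ z (y i)) : ℝ≥0) : ℝ≥0∞) := by
        refine Finset.sum_le_sum fun z _ => ?_
        refine (mul_le_mul_right (lintegral_rootRatio_le π hρ zs n z) _).trans ?_
        rw [← ENNReal.coe_mul]
        refine ENNReal.coe_le_coe.2 ?_
        rw [ht, mul_pow]
        refine mul_le_mul_right ?_ _
        rw [← NNReal.rpow_natCast, ← NNReal.rpow_natCast ((ρ ^ c) ^ n),
          ← NNReal.rpow_natCast (ρ ^ c), ← NNReal.rpow_mul, ← NNReal.rpow_mul]
        refine NNReal.rpow_le_rpow_of_exponent_ge hρ0 hρ1.le ?_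
        exact hd z
    _ = ENNReal.ofReal (∑ z ∈ (labelClassFinset π y)ᶜ,
          (t : ℝ) ^ hammingDist z (fun i => σ z (y i))) := by
        rw [ENNReal.ofReal_sum_of_nonneg fun _ _ => by positivity]
        refine Finset.sum_congr rfl fun z _ => ?_
        rw [← NNReal.coe_pow, ENNReal.ofReal_coe_nnreal]
    _ ≤ _ := ENNReal.ofReal_le_ofReal
        (sum_compl_pow_hammingDist_le π y σ hσ t t.2 hn)

/-! ### Almost sure convergence for a fixed label sequence. -/

/-- The divergence vanishes almost surely when all labels have a positive asymptotic frequency. -/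
theorem ae_tendsto_minKL (α : stdSimplex ℝ (Fin Q)) (π : Fin Q → Fin Q → unitInterval)
    (hA1 : ∀ q q' : Fin Q, q ≠ q' → ∃ l, π q l ≠ π q' l ∨ π l q ≠ π l q')
    {a : ℝ≥0} (ha : 0 < a) (hα : ∀ q, a ≤ (α q).toNNReal) (zs : Labels Q)
    {γ : ℝ} (hγ : 0 < γ) {n₀ : ℕ}
    (hzs : ∀ q, ∀ n ≥ n₀, γ * n ≤ (labelCount zs q n : ℝ)) :
    ∀ᵐ x ∂(edgeLaw π zs), Tendsto (fun n => minKL α π n x) atTop (𝓝 0) := by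
  have hQ : 0 < Q := (zs 0).pos
  have hQ' : (0 : ℝ) < Q := by exact_mod_cast hQ
  obtain ⟨ρ, hρ0, hρ1, hρ⟩ := exists_affinity_le π
  set β : ℝ≥0 := NNReal.sqrt a⁻¹
  set c : ℝ := (γ / Q) ^ 2 / 2 with hc
  have hc0 : 0 < c := by positivity
  have hr1 : ρ ^ c < 1 := NNReal.rpow_lt_one hρ1 hc0
  -- The identity is a dummy value for small `n`, so that `σ` is defined, and invariant, for all
  -- `n`.
  have hσ : ∀ n (z : Fin n → Fin Q), ∃ σ ∈ invariantPerms π, n₀ ≤ n → 2 ≤ γ / Q * n →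
      c * (n * hammingDist z (fun i => σ (labelsUpTo n zs i))) ≤
        ((differingEntries π z (labelsUpTo n zs)).card : ℝ) := by
    intro n z
    by_cases h : n₀ ≤ n ∧ 2 ≤ γ / Q * n
    · obtain ⟨σ, h1, h2⟩ := exists_perm_hammingDist_le π hA1 hQ z (labelsUpTo n zs) hγ
        (fun q => hzs q n h.1) h.2
      exact ⟨σ, h1, fun _ _ => h2⟩
    · exact ⟨1, fun _ _ => rfl, fun h1 h2 => absurd ⟨h1, h2⟩ h⟩
  choose σ hσinv hσd using hσ
  set u : ℕ → ℝ := fun n => n * (Q * ((β * (ρ ^ c) ^ n : ℝ≥0) : ℝ)) with hu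
  have hsum : Summable u := by
    have hgeom := summable_pow_mul_geometric_of_norm_lt_one 1
      (r := ((ρ ^ c : ℝ≥0) : ℝ)) (by rw [NNReal.norm_eq]; exact_mod_cast hr1)
    refine (hgeom.mul_left (Q * β : ℝ)).congr fun n => ?_
    simp only [hu]
    push_cast
    ring
  have hev : ∀ᶠ n : ℕ in atTop, n₀ ≤ n ∧ 2 ≤ γ / Q * n ∧ u n ≤ 1 :=
    (eventually_ge_atTop n₀).and
      (((tendsto_natCast_atTop_atTop.const_mul_atTop (by positivity)).eventually_ge_atTop 2).and
        (hsum.tendsto_atTop_zero.eventually_le_const zero_lt_one))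
  obtain ⟨m, hm⟩ := eventually_atTop.1 hev
  set T : ℕ → Adjacency → ℝ≥0∞ := fun n x => rootOdds π β (labelsUpTo n zs) (σ n) x
  have hTm : ∀ n, Measurable (T n) := fun n =>
    (measurable_rootOdds π β (labelsUpTo n zs) (σ n)).coe_nnreal_ennreal
  -- A Borel–Cantelli argument: the expectations are summable from `m` on, so the series is almost
  -- surely finite and its terms tend to `0`.
  have hTint : ∫⁻ x, ∑' n, T (n + m) x ∂(edgeLaw π zs) ≠ ∞ := by
    rw [lintegral_tsum fun n => (hTm _).aemeasurable]
    have hs : Summable fun n => Fintype.card (Equiv.Perm (Fin Q)) * (2 * u (n + m)) :=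
      (((summable_nat_add_iff m).2 hsum).mul_left 2).mul_left _
    refine ne_top_of_le_ne_top hs.tsum_ofReal_ne_top (ENNReal.tsum_le_tsum fun n => ?_)
    obtain ⟨h1, h2, h3⟩ := hm (n + m) (Nat.le_add_left m n)
    exact lintegral_rootOdds_le π hρ0 hρ1 hρ zs β c (n + m) (σ (n + m)) (hσinv _)
      (fun z => hσd _ z h1 h2) h3
  have hTfin := ae_lt_top (Measurable.tsum fun n => hTm (n + m)) hTint
  filter_upwards [hTfin, ae_likelihood_pos π zs] with x hx hpos
  have hT0 : Tendsto (fun n => T n x) atTop (𝓝 0) :=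
    (tendsto_add_atTop_iff_nat m).1 (ENNReal.tendsto_atTop_zero_of_tsum_ne_top hx.ne)
  have hT2 : Tendsto (fun n => T n x ^ 2) atTop (𝓝 0) := by
    simpa using ENNReal.Tendsto.pow (n := 2) hT0
  refine tendsto_of_tendsto_of_tendsto_of_le_of_le tendsto_const_nhds hT2
    (fun _ => zero_le) fun n => ?_
  refine (minKL_le_odds α π n x (labelsUpTo n zs)
    (mul_pos (prior_pos ha hα _) (hpos n))).trans ?_
  simp only [T]
  rw [← ENNReal.coe_pow]
  exact ENNReal.coe_le_coe.2
    (odds_le_sq π ha hα n x (labelsUpTo n zs) (hpos n) (σ n) (hσinv n))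

/-! ### Label frequencies and conclusion. -/

/-- The strong law of large numbers for the label frequencies. -/
theorem ae_tendsto_labelCount_div (α : stdSimplex ℝ (Fin Q)) (q : Fin Q) :
    ∀ᵐ zs ∂(labelLaw α), Tendsto (fun n : ℕ => (labelCount zs q n : ℝ) / n) atTop (𝓝 (α q)) := by
  set f : Fin Q → ℝ := fun l => if l = q then 1 else 0
  have hf : Measurable f := Measurable.of_discrete
  have hmp : ∀ i : ℕ, MeasurePreserving (fun zs : Labels Q => zs i) (labelLaw α)
      (categorical α) := fun i => measurePreserving_eval_infinitePi (fun _ => categorical α) i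
  have hident : ∀ i, IdentDistrib (fun zs : Labels Q => f (zs i)) (fun zs => f (zs 0))
      (labelLaw α) (labelLaw α) := by
    intro i
    have h : IdentDistrib (fun zs : Labels Q => zs i) (fun zs => zs 0)
        (labelLaw α) (labelLaw α) :=
      ⟨(hmp i).aemeasurable, (hmp 0).aemeasurable, (hmp i).map_eq.trans (hmp 0).map_eq.symm⟩
    exact h.comp hf
  have hind : iIndepFun (fun (i : ℕ) (zs : Labels Q) => f (zs i)) (labelLaw α) :=
    iIndepFun_infinitePi (X := fun _ => f) fun _ => hf
  have hint : Integrable (fun zs : Labels Q => f (zs 0)) (labelLaw α) :=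
    (hmp 0).integrable_comp_of_integrable (g := f) Integrable.of_finite
  have hmean : ∫ zs, f (zs 0) ∂(labelLaw α) = α q := by
    have h1 : ∫ zs, f (zs 0) ∂(labelLaw α) = ∫ l, f l ∂(categorical α) := by
      rw [← (hmp 0).map_eq, integral_map (hmp 0).aemeasurable hf.aestronglyMeasurable]
    rw [h1, integral_fintype Integrable.of_finite]
    simp [f, measureReal_def, categorical_singleton]
  have hslln := strong_law_ae_real (fun (i : ℕ) (zs : Labels Q) => f (zs i)) hint
    (fun i j hij => hind.indepFun hij) hident
  filter_upwards [hslln] with zs hzs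
  rw [hmean] at hzs
  refine hzs.congr fun n => ?_
  congr 1
  rw [← Fin.sum_univ_eq_sum_range (fun i => f (zs i)) n]
  simp only [f, labelCount, labelsUpTo, Finset.sum_boole]
  congr!

end SBM

end

theorem proposition4p1 {Q : ℕ} (α : stdSimplex ℝ (Fin Q)) (π : Fin Q → Fin Q → unitInterval)
    (hA1 : ∀ q q' : Fin Q, q ≠ q' → ∃ l, π q l ≠ π q' l ∨ π l q ≠ π l q')
    (hA2 : ∃ ζ : ℝ, 0 < ζ ∧ ∀ q l, (π q l : ℝ) ∈ Set.Ioo (0 : ℝ) 1 →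
      (π q l : ℝ) ∈ Set.Icc ζ (1 - ζ))
    (hA3 : ∃ γ : ℝ, 0 < γ ∧ γ < 1 / (Q : ℝ) ∧ ∀ q, α q ∈ Set.Icc γ (1 - γ)) :
    (∀ᵐ zs ∂(SBM.labelLaw α), ∀ᵐ x ∂(SBM.trueLaw π zs),
      Tendsto (fun n => SBM.minKL α π n x) atTop (𝓝 0)) ∧
    (∀ zs : SBM.Labels Q,
      (∃ γ : ℝ, 0 < γ ∧ ∃ n₀ : ℕ, 0 < n₀ ∧ ∀ q, ∀ n ≥ n₀,
        γ ≤ (SBM.labelCount zs q n : ℝ) / n) →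
      ∀ᵐ x ∂(SBM.trueLaw π zs), Tendsto (fun n => SBM.minKL α π n x) atTop (𝓝 0)) := by
  obtain ⟨a, ha, -, hα⟩ := hA3
  have hmain : ∀ zs : SBM.Labels Q,
      (∃ γ : ℝ, 0 < γ ∧ ∃ n₀ : ℕ, 0 < n₀ ∧ ∀ q, ∀ n ≥ n₀,
        γ ≤ (SBM.labelCount zs q n : ℝ) / n) →
      ∀ᵐ x ∂(SBM.trueLaw π zs), Tendsto (fun n => SBM.minKL α π n x) atTop (𝓝 0) := by
    rintro zs ⟨γ, hγ, n₀, hn₀, hzs⟩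
    refine SBM.ae_tendsto_minKL α π hA1 (Real.toNNReal_pos.2 ha)
      (fun q => Real.toNNReal_le_toNNReal (hα q).1) zs hγ (n₀ := n₀) fun q n hn => ?_
    exact (le_div_iff₀ (by exact_mod_cast hn₀.trans_le hn)).1 (hzs q n hn)
  refine ⟨?_, hmain⟩
  filter_upwards [ae_all_iff.2 (SBM.ae_tendsto_labelCount_div α)] with zs hzs
  -- The limits satisfy `α q ≥ a > a / 2`, and there are finitely many labels, so one threshold
  -- serves all of them.
  have hev : ∀ᶠ n : ℕ in atTop, ∀ q, a / 2 ≤ (SBM.labelCount zs q n : ℝ) / n :=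
    eventually_all.2 fun q => (hzs q).eventually_const_le (by linarith [(hα q).1])
  obtain ⟨n₀, hn₀⟩ := eventually_atTop.1 hev
  -- The shift to `n₀ + 1` makes the threshold positive.
  exact hmain zs ⟨a / 2, by positivity, n₀ + 1, by omega, fun q n hn => hn₀ n (by omega) q⟩
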